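/- Let $(A,\mathfrak m)$ be a (commutative) Noetherian local ring, let $M$ be a finitely generated $A$-module, and let $I\subsetneq A$ be a proper ideal. Let $\mathbf u=u_1,\dots,u_m$ be a minimal generating sequence of $I$ (it generates $I$, and no proper subsequence does), and for $i\ge 0$ let $H_i(I,M)=H_i(\mathbf u,M)$ be the $i$-th homology module of the Koszul complex $\mathbb K_\bullet(\mathbf u,M)$ of $\mathbf u$ with coefficients in $M$; up to isomorphism it does not depend on the choice of $\mathbf u$. (The zero module is regarded as having finite projective and injective dimension.) Then: 1. If $\operatorname{projdim}_A H_i(I,M)$ is finite for all $i$, then $\operatorname{projdim}_A M$ is finite. 2. If $\operatorname{injdim}_A H_i(I,M)$ is finite for all $i$, then $\operatorname{injdim}_A M$ is finite. -/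

import Mathlib

universe u v

section Koszul

variable {A : Type u} [CommRing A] {m : ℕ}

/-- A finite sequence `x = x_1, …, x_m` generates the ideal `I` minimally: it generates `I`, and
no sequence obtained by leaving out one of its members does. -/
def IsMinimalGeneratingSequence (x : Fin m → A) (I : Ideal A) : Prop :=
  Ideal.span (Set.range x) = I ∧ ∀ j : Fin m, Ideal.span (x '' {j}ᶜ) ≠ I

/-- The sign `(-1) ^ #{k ∈ t | k < j}`. -/
def koszulSign (t : Finset (Fin m)) (j : Fin m) : ℤˣ :=
  (-1) ^ (t.filter (· < j)).card

/-- The differential on the total Koszul module `⋀ (A ^ m) ⊗ M`. An element of that module is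
written as a function `f : Finset (Fin m) → M`, standing for `∑ s, e_s ⊗ f s`, where
`e_s = e_{s_1} ∧ ⋯ ∧ e_{s_n}` for `s = {s_1 < ⋯ < s_n}`. The differential is the `A`-linear map
`e_s ⊗ y ↦ ∑ r, (-1) ^ (r - 1) • e_{s \ {s_r}} ⊗ x_{s_r} y`; the coefficient of its value at `e_t`
is therefore a sum over all `j ∉ t`, the summand for `j` coming from `s = t ∪ {j}`. -/
def koszulD (x : Fin m → A) (M : Type v) [AddCommGroup M] [Module A M] :
    (Finset (Fin m) → M) →ₗ[A] (Finset (Fin m) → M) where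
  toFun f t := ∑ j ∈ tᶜ, koszulSign t j • x j • f (insert j t)
  map_add' f g := by
    funext t
    simp [smul_add, Finset.sum_add_distrib]
  map_smul' a f := by
    funext t
    simp only [Pi.smul_apply, RingHom.id_apply, Finset.smul_sum]
    refine Finset.sum_congr rfl fun j _ => ?_
    rw [smul_comm (x j) a, smul_comm (koszulSign t j) a]

theorem koszulSign_mul_add (t : Finset (Fin m)) {j k : Fin m} (hj : j ∉ t) (hk : k ∉ t)
    (hjk : j ≠ k) :
    koszulSign t k * koszulSign (insert k t) j = -(koszulSign t j * koszulSign (insert j t) k) := by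
  wlog h : j < k generalizing j k with H
  · rw [H hk hj hjk.symm (lt_of_le_of_ne (not_lt.1 h) hjk.symm), neg_neg]
  unfold koszulSign
  rw [Finset.filter_insert, Finset.filter_insert, if_neg (not_lt.2 h.le), if_pos h,
    Finset.card_insert_of_notMem (by simp [hj]), pow_succ]
  simp [mul_comm]

theorem koszulD_koszulD (x : Fin m → A) (M : Type v) [AddCommGroup M] [Module A M]
    (f : Finset (Fin m) → M) : koszulD x M (koszulD x M f) = 0 := by
  funext t
  simp only [koszulD, LinearMap.coe_mk, AddHom.coe_mk, Pi.zero_apply, Finset.smul_sum]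
  rw [Finset.sum_sigma']
  refine Finset.sum_involution (fun p _ => ⟨p.2, p.1⟩) ?_ ?_ ?_ ?_
  · rintro ⟨j, k⟩ h
    simp only [Finset.mem_sigma, Finset.mem_compl, Finset.mem_insert, not_or] at h
    obtain ⟨hj, hkj, hk⟩ := h
    simp only
    rw [smul_comm (x j), smul_comm (x k), Finset.insert_comm k j t, smul_comm (x k) (x j),
      smul_smul (koszulSign t j), smul_smul (koszulSign t k),
      koszulSign_mul_add t hj hk (Ne.symm hkj), Units.neg_smul, add_neg_cancel]
  · rintro ⟨j, k⟩ h _ he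
    simp only [Finset.mem_sigma, Finset.mem_compl, Finset.mem_insert, not_or] at h
    exact h.2.1 (congrArg Sigma.fst he)
  · rintro ⟨j, k⟩ h
    simp only [Finset.mem_sigma, Finset.mem_compl, Finset.mem_insert, not_or] at h ⊢
    exact ⟨h.2.2, Ne.symm h.2.1, h.1⟩
  · rintro ⟨j, k⟩ _
    rfl

/-- The degree `n` part `⋀ⁿ (A ^ m) ⊗ M` of the total Koszul module: the elements
`∑ s, e_s ⊗ f s` where only subsets `s` with `n` elements occur. -/
def koszulX (A : Type u) [CommRing A] (m : ℕ) (M : Type v) [AddCommGroup M] [Module A M] (n : ℕ) :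
    Submodule A (Finset (Fin m) → M) where
  carrier := {f | ∀ s, s.card ≠ n → f s = 0}
  zero_mem' _ _ := rfl
  add_mem' {f g} hf hg s hs := by simp [hf s hs, hg s hs]
  smul_mem' a f hf s hs := by simp [hf s hs]

theorem koszulD_mem (x : Fin m → A) (M : Type v) [AddCommGroup M] [Module A M] (n : ℕ) :
    ∀ f ∈ koszulX A m M (n + 1), koszulD x M f ∈ koszulX A m M n := by
  intro f hf t ht
  refine Finset.sum_eq_zero fun j hj => ?_
  rw [hf (insert j t), smul_zero, smul_zero]
  rw [Finset.card_insert_of_notMem (Finset.mem_compl.1 hj)]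
  omega

/-- The Koszul complex `K_•(x, M)` of the sequence `x = x_1, …, x_m` with coefficients in `M`. -/
noncomputable def koszulComplex (x : Fin m → A) (M : Type v) [AddCommGroup M] [Module A M] :
    ChainComplex (ModuleCat.{v} A) ℕ :=
  ChainComplex.of (fun n => ModuleCat.of A (koszulX A m M n))
    (fun n => ModuleCat.ofHom ((koszulD x M).restrict (koszulD_mem x M n)))
    (fun n => by
      ext f : 2
      exact Subtype.ext (koszulD_koszulD x M f.1))

/-- The Koszul homology module `H_i(x, M)`. -/
noncomputable def koszulHomology (x : Fin m → A) (M : Type v) [AddCommGroup M] [Module A M]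
    (i : ℕ) : ModuleCat.{v} A :=
  (koszulComplex x M).homology i

end Koszul

-- Let `k` be the residue field. For finite `M`, the projective dimension is finite iff `Ext^i(M, k)
-- = 0` for `i ≫ 0`, and the injective dimension is finite iff `Ext^i(k, M) = 0` for `i ≫ 0`. Both
-- conditions extend to objects `X` of the derived category: maps `X ⟶ k⟦n⟧`, respectively `k⟦-n⟧ ⟶
-- X`, vanish for `n ≫ 0`. Such `X` are closed under shifts and extensions, so a bounded complex
-- whose homology modules qualify qualifies itself (`prop_of_prop_homology`). This applies to the
-- Koszul complex of the whole sequence.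
--
-- The generators are then removed one at a time. The complex `K_{r+1}` on `r + 1` elements is the
-- cone of multiplication by the last of them on `K_r`, the complex on the others
-- (`exists_koszulStage_triangle`). That element lies in the maximal ideal and kills `k`, so
-- multiplication by it induces zero on Hom groups into or out of shifts of `k`; the long exact
-- sequence then carries vanishing from `K_{r+1}` to `K_r` (`eventuallyLeftOrthogonal_of_cone`,
-- `eventuallyRightOrthogonal_of_cone`). At the end `K_0` is `M` in degree `0`.

universe w' w t

open CategoryTheory Abelian Limits Pretriangulated Triangulated DerivedCategory

/-! ### Finite projective and injective dimension tested on the residue field -/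

section ExtVanishing

variable {A : Type u} [CommRing A]

/-- A property of finite modules over a Noetherian local ring that holds for the residue field and
is closed under extensions holds for every finite module, provided that it passes from
`N / xN` to `N` whenever `x` is an `N`-regular element of the maximal ideal. -/
theorem ModuleCat.induction_of_residueField [IsNoetherianRing A] [IsLocalRing A]
    (P : ModuleCat.{u} A → Prop)
    (zero : ∀ N, IsZero N → P N)
    (ext : ∀ S : ShortComplex (ModuleCat.{u} A), S.ShortExact → P S.X₁ → P S.X₃ → P S.X₂)
    (residue : P (ModuleCat.of A (IsLocalRing.ResidueField A)))
    (regular : ∀ N : ModuleCat.{u} A, Module.Finite A N → ∀ x ∈ IsLocalRing.maximalIdeal A,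
      IsSMulRegular N x → P (N.smulShortComplex x).X₃ → P N)
    (N : ModuleCat.{u} A) [Module.Finite A N] : P N := by
  have iso : ∀ {N N' : ModuleCat.{u} A}, (N ≅ N') → P N → P N' := fun {N N'} e h =>
    ext (ShortComplex.mk e.hom (0 : N' ⟶ ModuleCat.of A PUnit) (by simp))
      { exact := (ShortComplex.exact_iff_epi _ rfl).2 inferInstance
        mono_f := inferInstance
        epi_g := ((isZero_of_iff_subsingleton (M := ModuleCat.of A PUnit)).2 inferInstance).epi _ } h
      (zero _ ((isZero_of_iff_subsingleton).2 inferInstance))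
  have ext' : ∀ (N₁ N₂ N₃ : Type u) [AddCommGroup N₁] [Module A N₁] [AddCommGroup N₂]
      [Module A N₂] [AddCommGroup N₃] [Module A N₃] (f : N₁ →ₗ[A] N₂) (g : N₂ →ₗ[A] N₃)
      (_ : Function.Injective f) (_ : Function.Surjective g) (h : Function.Exact f g),
      P (of A N₁) → P (of A N₃) → P (of A N₂) := fun N₁ N₂ N₃ _ _ _ _ _ _ f g hf hg h h₁ h₃ =>
    ext (ShortComplex.mk (ofHom f) (ofHom g) (by ext x; exact h.apply_apply_eq_zero x))
      { exact := (ShortComplex.ShortExact.moduleCat_exact_iff_function_exact _).2 h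
        mono_f := (ModuleCat.mono_iff_injective _).2 hf
        epi_g := (ModuleCat.epi_iff_surjective _).2 hg } h₁ h₃
  -- Prime filtration: a finite module killed by `J` is built by extensions from modules `A ⧸ q`
  -- with `q ⊇ J`.
  have key : ∀ (J : Ideal A), (∀ q : PrimeSpectrum A, J ≤ q.1 → P (of A (A ⧸ q.1))) →
      ∀ (N : Type u) [AddCommGroup N] [Module A N] (_ : Module.Finite A N),
      J ≤ Module.annihilator A N → P (of A N) := by
    intro J hJ N _ _ hN
    refine IsNoetherianRing.induction_on_isQuotientEquivQuotientPrime A hN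
      (motive := fun N _ _ _ => J ≤ Module.annihilator A N → P (of A N)) ?_ ?_ ?_
    · intro N _ _ _ _ _
      exact zero _ ((isZero_of_iff_subsingleton).2 inferInstance)
    · intro N _ _ _ q e h
      refine iso e.symm.toModuleIso (hJ q ?_)
      rwa [e.annihilator_eq, Ideal.annihilator_quotient] at h
    · intro N₁ _ _ _ N₂ _ _ _ N₃ _ _ _ f g hf hg h h₁ h₃ h₂
      exact ext' _ _ _ f g hf hg h (h₁ (h₂.trans (f.annihilator_le_of_injective hf)))
        (h₃ (h₂.trans (g.annihilator_le_of_surjective hg)))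
  suffices ∀ J : Ideal A, J.IsPrime → P (of A (A ⧸ J)) from
    key ⊥ (fun q _ => this q.1 q.2) N inferInstance bot_le
  intro J
  induction J using WellFoundedGT.induction with
  | ind J ih =>
  intro hJ
  by_cases hm : J = IsLocalRing.maximalIdeal A
  · subst hm; exact residue
  -- Such an `x` is regular on the domain `A ⧸ J`, and the quotient by `x` is killed by `J ⊔ (x)`.
  -- Primes containing that ideal are strictly larger than `J`, so the induction hypothesis covers
  -- them.
  obtain ⟨x, hx, hxJ⟩ := SetLike.exists_of_lt
    (lt_of_le_of_ne (IsLocalRing.le_maximalIdeal hJ.ne_top) hm)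
  refine regular _ (inferInstanceAs (Module.Finite A (A ⧸ J))) x hx ?_
    (key (J ⊔ Ideal.span {x}) ?_ (QuotSMulTop x (A ⧸ J)) inferInstance ?_)
  · rw [isSMulRegular_iff_right_eq_zero_of_smul]
    rintro ⟨y⟩ hy
    change Ideal.Quotient.mk J (x * y) = 0 at hy
    rw [Ideal.Quotient.eq_zero_iff_mem] at hy
    exact Ideal.Quotient.eq_zero_iff_mem.2 ((hJ.mem_or_mem hy).resolve_left hxJ)
  · intro q hq
    have hx' : x ∈ q.1 := hq (Ideal.mem_sup_right (Ideal.mem_span_singleton_self x))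
    exact ih q.1 (lt_of_le_of_ne (le_sup_left.trans hq) (fun h => hxJ (h ▸ hx'))) q.2
  · refine sup_le ?_ ((Ideal.span_singleton_le_iff_mem _).2 ?_)
    · refine le_trans (Ideal.annihilator_quotient (I := J)).ge ?_
      exact LinearMap.annihilator_le_of_surjective _ (Submodule.mkQ_surjective _)
    · rw [Module.mem_annihilator]
      intro y
      induction y using Submodule.Quotient.induction_on with
      | H y =>
      exact (Submodule.Quotient.mk_eq_zero _).2 (Submodule.smul_mem_pointwise_smul _ _ _ trivial)

theorem CategoryTheory.Abelian.Ext.mk₀_smulShortComplex_f_comp {M N : ModuleCat.{u} A} (x : A)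
    {i : ℕ} (e : Ext N M i) :
    (Ext.mk₀ (N.smulShortComplex x).f).comp e (zero_add i) = x • e := by
  change (Ext.mk₀ (x • 𝟙 N)).comp e (zero_add i) = x • e
  rw [Ext.mk₀_smul, Ext.smul_comp, Ext.mk₀_id_comp]

theorem CategoryTheory.Abelian.Ext.comp_mk₀_smulShortComplex_f {M N : ModuleCat.{u} A} (x : A)
    {i : ℕ} (e : Ext M N i) :
    e.comp (Ext.mk₀ (N.smulShortComplex x).f) (add_zero i) = x • e := by
  change e.comp (Ext.mk₀ (x • 𝟙 N)) (add_zero i) = x • e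
  rw [Ext.mk₀_smul, Ext.comp_smul, Ext.comp_mk₀_id]

/-- In the regular step, `Ext^{i+1}(N/xN, M) = 0` makes multiplication by `x` surjective on the
finite module `Ext^i(N, M)`, which is zero by Nakayama. -/
theorem ModuleCat.subsingleton_ext_left_of_residueField [IsNoetherianRing A] [IsLocalRing A]
    (M : ModuleCat.{u} A) [Module.Finite A M] (n : ℕ)
    (h : ∀ i ≥ n, Subsingleton (Ext (ModuleCat.of A (IsLocalRing.ResidueField A)) M i))
    (N : ModuleCat.{u} A) [Module.Finite A N] : ∀ i ≥ n, Subsingleton (Ext N M i) := by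
  refine induction_of_residueField (fun N => ∀ i ≥ n, Subsingleton (Ext N M i)) ?_ ?_ h ?_ N
  · intro N hN i _
    refine subsingleton_of_forall_eq 0 fun e => ?_
    rw [← Ext.mk₀_id_comp e, hN.eq_of_src (𝟙 N) 0]
    simp
  · intro S hS h₁ h₃ i hi
    refine subsingleton_of_forall_eq 0 fun e => ?_
    have := h₁ i hi
    have := h₃ i hi
    obtain ⟨e', rfl⟩ := Ext.contravariant_sequence_exact₂ hS M e (Subsingleton.elim _ _)
    rw [Subsingleton.elim e' 0, Ext.comp_zero]
  · intro N _ x hx hN h i hi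
    have := h (i + 1) (by omega)
    refine Submodule.subsingleton_iff A |>.1 (subsingleton_of_bot_eq_top ?_)
    refine (Submodule.eq_bot_of_le_smul_of_le_jacobson_bot (Ideal.span {x}) ⊤
      Module.Finite.fg_top ?_ ?_).symm
    · intro e _
      obtain ⟨e', he⟩ := Ext.contravariant_sequence_exact₁ hN.smulShortComplex_shortExact M e
        (add_comm 1 i) (Subsingleton.elim _ _)
      rw [← (Ext.mk₀_smulShortComplex_f_comp (N := N) x e').symm.trans he]
      exact Submodule.smul_mem_smul (Ideal.mem_span_singleton_self x) trivial
    · rw [IsLocalRing.jacobson_eq_maximalIdeal ⊥ bot_ne_top]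
      exact (Ideal.span_singleton_le_iff_mem _).2 hx

/-- The same Nakayama argument in the other variable; here the obstruction `Ext^i(M, N/xN)` sits in
the same degree. -/
theorem ModuleCat.subsingleton_ext_right_of_residueField [IsNoetherianRing A] [IsLocalRing A]
    (M : ModuleCat.{u} A) [Module.Finite A M] (n : ℕ)
    (h : ∀ i ≥ n, Subsingleton (Ext M (ModuleCat.of A (IsLocalRing.ResidueField A)) i))
    (N : ModuleCat.{u} A) [Module.Finite A N] : ∀ i ≥ n, Subsingleton (Ext M N i) := by
  refine induction_of_residueField (fun N => ∀ i ≥ n, Subsingleton (Ext M N i)) ?_ ?_ h ?_ N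
  · intro N hN i _
    refine subsingleton_of_forall_eq 0 fun e => ?_
    rw [← Ext.comp_mk₀_id e, hN.eq_of_src (𝟙 N) 0]
    simp
  · intro S hS h₁ h₃ i hi
    refine subsingleton_of_forall_eq 0 fun e => ?_
    have := h₁ i hi
    have := h₃ i hi
    obtain ⟨e', rfl⟩ := Ext.covariant_sequence_exact₂ M hS e (Subsingleton.elim _ _)
    rw [Subsingleton.elim e' 0, Ext.zero_comp]
  · intro N _ x hx hN h i hi
    have := h i hi
    refine Submodule.subsingleton_iff A |>.1 (subsingleton_of_bot_eq_top ?_)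
    refine (Submodule.eq_bot_of_le_smul_of_le_jacobson_bot (Ideal.span {x}) ⊤
      Module.Finite.fg_top ?_ ?_).symm
    · intro e _
      obtain ⟨e', he⟩ := Ext.covariant_sequence_exact₂ M hN.smulShortComplex_shortExact e
        (Subsingleton.elim _ _)
      rw [← (Ext.comp_mk₀_smulShortComplex_f (N := N) x e').symm.trans he]
      exact Submodule.smul_mem_smul (Ideal.mem_span_singleton_self x) trivial
    · rw [IsLocalRing.jacobson_eq_maximalIdeal ⊥ bot_ne_top]
      exact (Ideal.span_singleton_le_iff_mem _).2 hx

/-- Dimension shifting along syzygies, which remain finite over a Noetherian ring. For `n = 0` the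
vanishing of `Ext^1(M, ker f)` splits the presentation `f`. -/
theorem ModuleCat.hasProjectiveDimensionLE_of_subsingleton_ext [IsNoetherianRing A] (n : ℕ)
    (M : ModuleCat.{u} A) [Module.Finite A M]
    (h : ∀ (N : ModuleCat.{u} A) [Module.Finite A N], Subsingleton (Ext M N (n + 1))) :
    HasProjectiveDimensionLE M n := by
  induction n generalizing M with
  | zero =>
    obtain ⟨P, _, _, _, _, f, hf⟩ := Module.exists_finite_presentation A M
    have hS := LinearMap.shortExact_shortComplexKer hf
    have hP : Projective (f.shortComplexKer).X₂ :=
      ModuleCat.projective_of_categoryTheory_projective _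
    have := h (of A (LinearMap.ker f))
    obtain ⟨s, hs⟩ := Ext.covariant_sequence_exact₃ M hS (Ext.mk₀ (𝟙 M)) (zero_add 1)
      (Subsingleton.elim (α := Ext M (of A (LinearMap.ker f)) 1) _ _)
    obtain ⟨s, rfl⟩ := Ext.homEquiv₀.symm.surjective s
    rw [← projective_iff_hasProjectiveDimensionLE_zero]
    refine Retract.projective (X := M) (Y := (f.shortComplexKer).X₂)
      ⟨s, (f.shortComplexKer).g, Ext.homEquiv₀.symm.injective ?_⟩
    simpa using hs
  | succ n ih =>
    obtain ⟨P, _, _, _, _, f, hf⟩ := Module.exists_finite_presentation A M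
    have hS := LinearMap.shortExact_shortComplexKer hf
    have hP : Projective (f.shortComplexKer).X₂ :=
      ModuleCat.projective_of_categoryTheory_projective _
    refine (hS.hasProjectiveDimensionLT_X₃_iff n hP).2 (ih (of A (LinearMap.ker f)) fun N _ => ?_)
    refine subsingleton_of_forall_eq 0 fun e => ?_
    have := h N
    obtain ⟨e', rfl⟩ := Ext.contravariant_sequence_exact₁ hS N e (add_comm 1 _)
      (Subsingleton.elim (α := Ext M N (n + 1 + 1)) _ _)
    rw [Ext.eq_zero_of_projective e', Ext.comp_zero]

/-- Finite test modules suffice by Baer's criterion: the obstruction to extending a map from `J` to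
`A` lies in `Ext^1(A ⧸ J, M)`. Cosyzygies need not be finite, hence no finiteness is asked of `M`.
-/
theorem ModuleCat.hasInjectiveDimensionLE_of_subsingleton_ext (n : ℕ) (M : ModuleCat.{u} A)
    (h : ∀ (N : ModuleCat.{u} A) [Module.Finite A N], Subsingleton (Ext N M (n + 1))) :
    HasInjectiveDimensionLE M n := by
  induction n generalizing M with
  | zero =>
    rw [HasInjectiveDimensionLE, zero_add, ← injective_iff_hasInjectiveDimensionLT_one,
      ← Module.injective_iff_injective_object, ← Module.Baer.iff_injective]
    intro J g
    have hS := LinearMap.shortExact_shortComplexKer (Submodule.mkQ_surjective J)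
    have := h (of A (A ⧸ J))
    let ι : J ≃ₗ[A] LinearMap.ker J.mkQ := LinearEquiv.ofEq _ _ J.ker_mkQ.symm
    obtain ⟨e, he⟩ := Ext.contravariant_sequence_exact₁ hS M
      (Ext.mk₀ (ofHom (g ∘ₗ ι.symm.toLinearMap))) (add_zero 1)
      (Subsingleton.elim (α := Ext (of A (A ⧸ J)) M 1) _ _)
    obtain ⟨s, rfl⟩ := Ext.homEquiv₀.symm.surjective e
    have hs : (J.mkQ.shortComplexKer).f ≫ s = ofHom (g ∘ₗ ι.symm.toLinearMap) :=
      Ext.homEquiv₀.symm.injective (by simpa using he)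
    refine ⟨s.hom, fun y hy => ?_⟩
    exact congr($hs (ι ⟨y, hy⟩))
  | succ n ih =>
    have ei : EnoughInjectives (ModuleCat.{u} A) := inferInstance
    obtain ⟨I, inj, f, _⟩ := ei.1 M
    have hS : (ShortComplex.mk f (cokernel.π f) (cokernel.condition f)).ShortExact :=
      { exact := ShortComplex.exact_cokernel f }
    refine (hS.hasInjectiveDimensionLT_X₃_iff n inj).1 (ih _ fun N _ => ?_)
    refine subsingleton_of_forall_eq 0 fun e => ?_
    have := h N
    obtain ⟨e', rfl⟩ := Ext.covariant_sequence_exact₃ N hS e rfl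
      (Subsingleton.elim (α := Ext N M (n + 1 + 1)) _ _)
    rw [Ext.eq_zero_of_injective e', Ext.zero_comp]

end ExtVanishing

/-! ### Eventual orthogonality in triangulated categories -/

section Orthogonality

namespace CategoryTheory.Pretriangulated

variable {T : Type u} [Category.{v} T] [Preadditive T] [HasShift T ℤ]

/-- The objects `X` such that every morphism `X ⟶ Z⟦n⟧` vanishes for `n ≫ 0`. -/
def eventuallyLeftOrthogonal (Z : T) : ObjectProperty T :=
  fun X => ∃ N : ℤ, ∀ n ≥ N, ∀ f : X ⟶ Z⟦n⟧, f = 0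

/-- The objects `X` such that every morphism `Z⟦-n⟧ ⟶ X` vanishes for `n ≫ 0`. -/
def eventuallyRightOrthogonal (Z : T) : ObjectProperty T :=
  fun X => ∃ N : ℤ, ∀ n ≥ N, ∀ f : Z⟦-n⟧ ⟶ X, f = 0

theorem eventuallyLeftOrthogonal_of_isZero {Z X : T} (hX : IsZero X) :
    eventuallyLeftOrthogonal Z X :=
  ⟨0, fun _ _ _ => hX.eq_of_src _ _⟩

theorem eventuallyRightOrthogonal_of_isZero {Z X : T} (hX : IsZero X) :
    eventuallyRightOrthogonal Z X :=
  ⟨0, fun _ _ _ => hX.eq_of_tgt _ _⟩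

instance (Z : T) : (eventuallyLeftOrthogonal Z).IsClosedUnderIsomorphisms where
  of_iso e := fun ⟨N, hN⟩ => ⟨N, fun n hn f => by
    rw [← cancel_epi e.hom, hN n hn (e.hom ≫ f), comp_zero]⟩

instance (Z : T) : (eventuallyRightOrthogonal Z).IsClosedUnderIsomorphisms where
  of_iso e := fun ⟨N, hN⟩ => ⟨N, fun n hn f => by
    rw [← cancel_mono e.inv, hN n hn (f ≫ e.inv), zero_comp]⟩

variable [∀ n : ℤ, (shiftFunctor T n).Additive]

theorem smul_id_shift_eq_zero {A : Type t} [CommRing A] [Linear A T]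
    [∀ n : ℤ, (shiftFunctor T n).Linear A] {Z : T} {a : A} (ha : a • 𝟙 Z = 0) (n : ℤ) : a • 𝟙 (Z⟦n⟧) = 0 := by
  rw [← (shiftFunctor T n).map_id, ← Functor.map_smul, ha, Functor.map_zero]

instance (Z : T) : (eventuallyLeftOrthogonal Z).IsStableUnderShift ℤ where
  isStableUnderShiftBy a :=
    { le_shift := fun X ⟨N, hN⟩ => ⟨N + a, fun n hn f => by
        apply (shiftFunctor T (-a)).map_injective
        rw [Functor.map_zero, ← cancel_epi ((shiftFunctorCompIsoId T a (-a) (by simp)).inv.app X),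
          ← cancel_mono ((shiftFunctorAdd' T n (-a) (n - a) (by omega)).inv.app Z),
          comp_zero, zero_comp]
        exact hN _ (by omega) _⟩ }

instance (Z : T) : (eventuallyRightOrthogonal Z).IsStableUnderShift ℤ where
  isStableUnderShiftBy a :=
    { le_shift := fun X ⟨N, hN⟩ => ⟨N - a, fun n hn f => by
        apply (shiftFunctor T (-a)).map_injective
        rw [Functor.map_zero, ← cancel_mono ((shiftFunctorCompIsoId T a (-a) (by simp)).hom.app X),
          ← cancel_epi ((shiftFunctorAdd' T (-n) (-a) (-(n + a)) (by omega)).hom.app Z),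
          zero_comp, comp_zero]
        exact hN _ (by omega) _⟩ }

/-- Shifting the test object `Z` lets exactness apply to a triangle without shifting it; shifting
`X` gives the form that matches Ext. -/
theorem eventuallyRightOrthogonal_iff (Z X : T) :
    eventuallyRightOrthogonal Z X ↔ ∃ N : ℤ, ∀ n ≥ N, ∀ f : Z ⟶ X⟦n⟧, f = 0 := by
  refine exists_congr fun N => forall₂_congr fun n _ => ⟨fun h f => ?_, fun h f => ?_⟩
  · apply (shiftFunctor T (-n)).map_injective
    rw [Functor.map_zero, ← cancel_mono ((shiftFunctorCompIsoId T n (-n) (by simp)).hom.app X),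
      zero_comp]
    exact h _
  · apply (shiftFunctor T n).map_injective
    rw [Functor.map_zero, ← cancel_epi ((shiftFunctorCompIsoId T (-n) n (by simp)).inv.app Z),
      comp_zero]
    exact h _

variable [HasZeroObject T] [Pretriangulated T]

instance (Z : T) : (eventuallyLeftOrthogonal Z).IsTriangulatedClosed₂ where
  ext₂' := fun X hX ⟨N₁, h₁⟩ ⟨N₃, h₃⟩ => ObjectProperty.le_isoClosure _ _
    ⟨max N₁ N₃, fun n hn f => by
      obtain ⟨g, rfl⟩ := X.yoneda_exact₂ hX f (h₁ n (le_of_max_le_left hn) _)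
      rw [h₃ n (le_of_max_le_right hn) g, comp_zero]⟩

instance (Z : T) : (eventuallyRightOrthogonal Z).IsTriangulatedClosed₂ where
  ext₂' := fun X hX ⟨N₁, h₁⟩ ⟨N₃, h₃⟩ => ObjectProperty.le_isoClosure _ _
    ⟨max N₁ N₃, fun n hn f => by
      obtain ⟨g, rfl⟩ := X.coyoneda_exact₂ hX f (h₃ n (le_of_max_le_right hn) _)
      rw [h₁ n (le_of_max_le_left hn) g, zero_comp]⟩

variable {A : Type t} [CommRing A] [Linear A T] [∀ n : ℤ, (shiftFunctor T n).Linear A]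

/-- The scalar `a` moves across a composite onto `Z⟦n⟧`, where it is zero. So every map `X.obj₁⟦1⟧ ⟶
Z⟦n⟧` is killed by `X.mor₃` and factors through `X.obj₂⟦1⟧`. -/
theorem eventuallyLeftOrthogonal_of_cone {Z : T} {a : A} (ha : a • 𝟙 Z = 0) {X : Triangle T}
    (hX : X ∈ distTriang T) (e : X.obj₃ ⟶ X.obj₁⟦(1 : ℤ)⟧) (he : X.mor₃ = a • e)
    (h : eventuallyLeftOrthogonal Z X.obj₂) : eventuallyLeftOrthogonal Z X.obj₁ := by
  rw [← ObjectProperty.prop_shift_iff_of_isStableUnderShift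
    (eventuallyLeftOrthogonal Z) _ (1 : ℤ)] at h ⊢
  obtain ⟨N, hN⟩ := h
  refine ⟨N, fun n hn f => ?_⟩
  obtain ⟨g, rfl⟩ := X.rotate.yoneda_exact₃ (rot_of_distTriang _ hX) f (by
    change X.mor₃ ≫ f = 0
    rw [he, Linear.smul_comp, ← Linear.comp_smul, ← Category.comp_id f, ← Linear.comp_smul,
      smul_id_shift_eq_zero ha, comp_zero, comp_zero])
  exact (congrArg (X.rotate.mor₃ ≫ ·) (hN n hn g)).trans comp_zero

/-- Dually, a map into `X.obj₁⟦1⟧` that dies in `X.obj₂⟦1⟧` factors through `X.mor₃ = a • e`, and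
`a` moves onto the source, where it is zero. -/
theorem eventuallyRightOrthogonal_of_cone {Z : T} {a : A} (ha : a • 𝟙 Z = 0) {X : Triangle T}
    (hX : X ∈ distTriang T) (e : X.obj₃ ⟶ X.obj₁⟦(1 : ℤ)⟧) (he : X.mor₃ = a • e)
    (h : eventuallyRightOrthogonal Z X.obj₂) : eventuallyRightOrthogonal Z X.obj₁ := by
  rw [← ObjectProperty.prop_shift_iff_of_isStableUnderShift
    (eventuallyRightOrthogonal Z) _ (1 : ℤ)] at h ⊢
  obtain ⟨N, hN⟩ := h
  refine ⟨N, fun n hn f => ?_⟩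
  obtain ⟨g, rfl⟩ := X.coyoneda_exact₁ hX f (hN n hn _)
  rw [he, Linear.comp_smul, ← Linear.smul_comp, ← Category.id_comp g, ← Linear.smul_comp,
      smul_id_shift_eq_zero ha, zero_comp, zero_comp]

end CategoryTheory.Pretriangulated

/-! ### Dévissage along homology, and translation to Ext -/

namespace DerivedCategory

variable {C : Type u} [Category.{v} C] [Abelian C] [HasDerivedCategory.{w} C]

/-- Induction on the number of degrees in `[a, b]`: the truncation triangle splits off the top
homology as a single object, and the rest has smaller amplitude. -/
theorem prop_of_prop_homology (P : ObjectProperty (DerivedCategory C))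
    [P.IsClosedUnderIsomorphisms] [P.IsTriangulatedClosed₂] (zero : ∀ X, IsZero X → P X)
    (X : DerivedCategory C) (a b : ℤ) [X.IsGE a] [X.IsLE b]
    (h : ∀ i : ℤ, P ((singleFunctor C i).obj ((homologyFunctor C i).obj X))) : P X := by
  obtain ⟨k, hk⟩ : ∃ k : ℕ, b ≤ a + k - 1 := ⟨(b - a + 1).toNat, by omega⟩
  induction k generalizing X b with
  | zero => exact zero _ (TStructure.t.isZero X b a (by omega))
  | succ k ih =>
    obtain ⟨Y, Z, hY, hZ, f, g, δ, hT⟩ := TStructure.t.exists_triangle X (b - 1) b (by omega)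
    have : Y.IsLE (b - 1) := ⟨hY⟩
    have : Z.IsGE b := ⟨hZ⟩
    have hY' : ∀ i < b, IsIso ((homologyFunctor C i).map f) := fun i hi => by
      have : Mono ((homologyFunctor C i).map f) := (HomologySequence.mono_homologyMap_mor₁_iff _ hT (i - 1) i (by omega)).2
        ((Z.isZero_of_isGE b (i - 1) (by omega)).eq_of_src _ _)
      have : Epi ((homologyFunctor C i).map f) := (HomologySequence.epi_homologyMap_mor₁_iff _ hT i).2
        ((Z.isZero_of_isGE b i hi).eq_of_tgt _ _)
      exact isIso_of_mono_of_epi ((homologyFunctor C i).map f)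
    have hZ' : ∀ i ≥ b, IsIso ((homologyFunctor C i).map g) := fun i hi => by
      have : Epi ((homologyFunctor C i).map g) := (HomologySequence.epi_homologyMap_mor₂_iff _ hT i (i + 1) rfl).2
        ((Y.isZero_of_isLE (b - 1) (i + 1) (by omega)).eq_of_tgt _ _)
      have : Mono ((homologyFunctor C i).map g) := (HomologySequence.mono_homologyMap_mor₂_iff _ hT i).2
        ((Y.isZero_of_isLE (b - 1) i (by omega)).eq_of_src _ _)
      exact isIso_of_mono_of_epi ((homologyFunctor C i).map g)
    refine P.ext_of_isTriangulatedClosed₂ _ hT ?_ ?_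
    · have : Y.IsGE a := by
        rw [isGE_iff]
        intro i hi
        by_cases hib : i < b
        · have := hY' i hib
          exact (X.isZero_of_isGE a i hi).of_iso (asIso ((homologyFunctor C i).map f))
        · exact Y.isZero_of_isLE (b - 1) i (by omega)
      refine ih Y (b - 1) (fun i => ?_) (by omega)
      by_cases hib : i < b
      · have := hY' i hib
        exact P.prop_of_iso ((singleFunctor C i).mapIso (asIso ((homologyFunctor C i).map f))).symm
          (h i)
      · exact zero _ ((singleFunctor C i).map_isZero (Y.isZero_of_isLE (b - 1) i (by omega)))
    · have : Z.IsLE b := by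
        rw [isLE_iff]
        intro i hi
        have := hZ' i hi.le
        exact (X.isZero_of_isLE b i hi).of_iso (asIso ((homologyFunctor C i).map g)).symm
      have := hZ' b le_rfl
      obtain ⟨W, ⟨e⟩⟩ := Z.exists_iso_singleFunctor_obj_of_isGE_of_isLE b
      have e' : (homologyFunctor C b).obj Z ≅ W :=
        (homologyFunctor C b).mapIso e ≪≫
          (singleFunctorCompHomologyFunctorIso C b).app W
      exact P.prop_of_iso ((singleFunctor C b).mapIso
        (asIso ((homologyFunctor C b).map g) ≪≫ e') ≪≫ e.symm) (h b)

theorem prop_single_iff (P : ObjectProperty (DerivedCategory C)) [P.IsClosedUnderIsomorphisms]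
    [P.IsStableUnderShift ℤ] (X : C) (n : ℤ) :
    P ((singleFunctor C n).obj X) ↔ P ((singleFunctor C 0).obj X) := by
  rw [← P.prop_shift_iff_of_isStableUnderShift _ n]
  exact P.prop_iff_of_iso (((singleFunctors C).shiftIso n 0 n (add_zero n)).app X)

variable [HasExt.{w'} C]

theorem eventuallyLeftOrthogonal_single_iff (Z X : C) :
    eventuallyLeftOrthogonal ((singleFunctor C 0).obj Z) ((singleFunctor C 0).obj X) ↔
      ∃ n : ℕ, ∀ i ≥ n, Subsingleton (Abelian.Ext.{w'} X Z i) := by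
  constructor
  · rintro ⟨N, hN⟩
    refine ⟨N.toNat, fun i hi => ?_⟩
    refine Abelian.Ext.homEquiv.subsingleton_congr.2 (subsingleton_of_forall_eq 0 ?_)
    exact hN i (by omega)
  · rintro ⟨N, hN⟩
    refine ⟨N, fun n hn f => ?_⟩
    obtain ⟨n, rfl⟩ := Int.eq_ofNat_of_zero_le (by omega : 0 ≤ n)
    have := Abelian.Ext.homEquiv.subsingleton_congr.1 (hN n (by omega))
    exact Subsingleton.elim (α := ShiftedHom _ _ _) f 0

theorem eventuallyRightOrthogonal_single_iff (Z X : C) :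
    eventuallyRightOrthogonal ((singleFunctor C 0).obj Z) ((singleFunctor C 0).obj X) ↔
      ∃ n : ℕ, ∀ i ≥ n, Subsingleton (Abelian.Ext.{w'} Z X i) := by
  rw [eventuallyRightOrthogonal_iff]
  -- After the rewrite the left side unfolds to left orthogonality with the roles of `X` and `Z`
  -- exchanged.
  exact eventuallyLeftOrthogonal_single_iff X Z

end DerivedCategory

end Orthogonality

/-! ### Filtration of the Koszul complex by initial segments of the sequence -/

section KoszulFiltration

variable {A : Type u} [CommRing A] {m : ℕ}

/-- The elements of degree `n` of the total Koszul module (in cohomological grading, so that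
`e_s ⊗ y` has degree `-#s`) which only involve `e_i` for `i < r`. -/
def koszulStageX (A : Type u) [CommRing A] (m : ℕ) (M : Type v) [AddCommGroup M] [Module A M]
    (r : ℕ) (n : ℤ) : Submodule A (Finset (Fin m) → M) where
  carrier := {f | ∀ s, ¬ (-(s.card : ℤ) = n ∧ ∀ i ∈ s, i.1 < r) → f s = 0}
  zero_mem' _ _ := rfl
  add_mem' {f g} hf hg s hs := by simp [hf s hs, hg s hs]
  smul_mem' a f hf s hs := by simp [hf s hs]

variable (x : Fin m → A) (M : Type v) [AddCommGroup M] [Module A M]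

theorem koszulD_mem_koszulStageX (r : ℕ) {n n' : ℤ} (h : n + 1 = n') :
    ∀ f ∈ koszulStageX A m M r n, koszulD x M f ∈ koszulStageX A m M r n' := by
  intro f hf t ht
  refine Finset.sum_eq_zero fun j hj => ?_
  rw [hf (insert j t), smul_zero, smul_zero]
  rintro ⟨h₁, h₂⟩
  rw [Finset.card_insert_of_notMem (Finset.mem_compl.1 hj)] at h₁
  exact ht ⟨by push_cast at h₁; omega, fun i hi => h₂ i (Finset.mem_insert_of_mem hi)⟩

/-- The Koszul complex of `x_1, …, x_r` with coefficients in `M`, in cohomological grading, as a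
subcomplex of the Koszul complex of `x_1, …, x_m`. -/
noncomputable def koszulStage (r : ℕ) : CochainComplex (ModuleCat.{v} A) ℤ where
  X n := ModuleCat.of A (koszulStageX A m M r n)
  d n n' := if h : n + 1 = n' then
    ModuleCat.ofHom ((koszulD x M).restrict (koszulD_mem_koszulStageX x M r h)) else 0
  shape n n' h := dif_neg h
  d_comp_d' n n' n'' h h' := by
    rw [dif_pos (show n + 1 = n' from h), dif_pos (show n' + 1 = n'' from h')]
    ext f : 2
    exact Subtype.ext (koszulD_koszulD x M f.1)

theorem koszulStage_d_apply (r : ℕ) {n n' : ℤ} (h : n + 1 = n') (f : koszulStageX A m M r n) :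
    ((koszulStage x M r).d n n' f : koszulStageX A m M r n').1 = koszulD x M f.1 := by
  simp only [koszulStage, dif_pos h]
  rfl

variable {M}

/-- The quotient map `e_{t ∪ {r}} ↦ (-1) ^ #t e_t` on the total Koszul module. -/
def koszulContract (A : Type u) [CommRing A] [Module A M] (r : Fin m) :
    (Finset (Fin m) → M) →ₗ[A] (Finset (Fin m) → M) where
  toFun f t := if r ∈ t then 0 else (-1 : ℤˣ) ^ t.card • f (insert r t)
  map_add' f g := by
    funext t; dsimp only [Pi.add_apply]; split_ifs <;> simp [smul_add]
  map_smul' a f := by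
    funext t; dsimp only [Pi.smul_apply, RingHom.id_apply]; split_ifs
    · simp
    · rw [smul_comm]

/-- The map `e_t ↦ (-1) ^ #t e_{t ∪ {r}}` on the total Koszul module. -/
def koszulExtend (A : Type u) [CommRing A] [Module A M] (r : Fin m) :
    (Finset (Fin m) → M) →ₗ[A] (Finset (Fin m) → M) where
  toFun f t := if r ∈ t then (-1 : ℤˣ) ^ (t.erase r).card • f (t.erase r) else 0
  map_add' f g := by
    funext t; dsimp only [Pi.add_apply]; split_ifs <;> simp [smul_add]
  map_smul' a f := by
    funext t; dsimp only [Pi.smul_apply, RingHom.id_apply]; split_ifs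
    · rw [smul_comm]
    · simp

/-- The projection of the total Koszul module which forgets all `e_t` with `r ∈ t`. -/
def koszulProj (A : Type u) [CommRing A] [Module A M] (r : Fin m) :
    (Finset (Fin m) → M) →ₗ[A] (Finset (Fin m) → M) where
  toFun f t := if r ∈ t then 0 else f t
  map_add' f g := by
    funext t; dsimp only [Pi.add_apply]; split_ifs <;> simp
  map_smul' a f := by
    funext t; dsimp only [Pi.smul_apply, RingHom.id_apply]; split_ifs <;> simp

theorem koszulStageX_mono {r r' : ℕ} (h : r ≤ r') (n : ℤ) :
    koszulStageX A m M r n ≤ koszulStageX A m M r' n := fun _ hf s hs =>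
  hf s fun hs' => hs ⟨hs'.1, fun i hi => (hs'.2 i hi).trans_le h⟩

theorem koszulContract_mem (r : Fin m) {n n' : ℤ} (h : n + 1 = n') :
    ∀ f ∈ koszulStageX A m M (r.1 + 1) n, koszulContract A r f ∈ koszulStageX A m M r.1 n' := by
  intro f hf t ht
  dsimp only [koszulContract, LinearMap.coe_mk, AddHom.coe_mk]
  split_ifs with hr
  · rfl
  rw [hf, smul_zero]
  rintro ⟨h₁, h₂⟩
  rw [Finset.card_insert_of_notMem hr] at h₁
  refine ht ⟨by push_cast at h₁; omega, fun i hi => ?_⟩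
  have := h₂ i (Finset.mem_insert_of_mem hi)
  have : i.1 ≠ r.1 := fun h => hr (Fin.ext h ▸ hi)
  omega

theorem koszulExtend_mem (r : Fin m) {n n' : ℤ} (h : n + 1 = n') :
    ∀ f ∈ koszulStageX A m M r.1 n', koszulExtend A r f ∈ koszulStageX A m M (r.1 + 1) n := by
  intro f hf t ht
  dsimp only [koszulExtend, LinearMap.coe_mk, AddHom.coe_mk]
  split_ifs with hr
  · rw [hf, smul_zero]
    rintro ⟨h₁, h₂⟩
    have := Finset.card_erase_add_one hr
    refine ht ⟨by omega, fun i hi => ?_⟩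
    by_cases hir : i = r
    · rw [hir]; omega
    · have := h₂ i (Finset.mem_erase.2 ⟨hir, hi⟩)
      omega
  · rfl

theorem koszulProj_mem (r : Fin m) (n : ℤ) :
    ∀ f ∈ koszulStageX A m M (r.1 + 1) n, koszulProj A r f ∈ koszulStageX A m M r.1 n := by
  intro f hf t ht
  dsimp only [koszulProj, LinearMap.coe_mk, AddHom.coe_mk]
  split_ifs with hr
  · rfl
  refine hf t fun ⟨h₁, h₂⟩ => ht ⟨h₁, fun i hi => ?_⟩
  have := h₂ i hi
  have : i.1 ≠ r.1 := fun h => hr (Fin.ext h ▸ hi)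
  omega

theorem koszulProj_apply_of_mem (r : Fin m) {n : ℤ} {f : Finset (Fin m) → M}
    (hf : f ∈ koszulStageX A m M r.1 n) : koszulProj A r f = f := by
  funext t
  dsimp only [koszulProj, LinearMap.coe_mk, AddHom.coe_mk]
  split_ifs with hr
  · exact (hf t fun h => lt_irrefl _ (h.2 r hr)).symm
  · rfl

theorem koszulContract_apply_of_mem (r : Fin m) {n : ℤ} {f : Finset (Fin m) → M}
    (hf : f ∈ koszulStageX A m M r.1 n) : koszulContract A r f = 0 := by
  funext t
  dsimp only [koszulContract, LinearMap.coe_mk, AddHom.coe_mk]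
  split_ifs with hr
  · rfl
  · rw [hf _ fun h => lt_irrefl _ (h.2 r (Finset.mem_insert_self _ _)), smul_zero]; rfl

theorem koszulContract_koszulExtend (r : Fin m) {n : ℤ} {f : Finset (Fin m) → M}
    (hf : f ∈ koszulStageX A m M r.1 n) : koszulContract A r (koszulExtend A r f) = f := by
  funext t
  dsimp only [koszulContract, koszulExtend, LinearMap.coe_mk, AddHom.coe_mk]
  split_ifs with hr hr'
  · exact (hf t fun h => lt_irrefl _ (h.2 r hr)).symm
  · rw [Finset.erase_insert hr, smul_smul, ← mul_pow]; simp
  · exact absurd (Finset.mem_insert_self _ _) hr'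

theorem koszulProj_add_koszulExtend_koszulContract (r : Fin m) (f : Finset (Fin m) → M) :
    koszulProj A r f + koszulExtend A r (koszulContract A r f) = f := by
  funext t
  dsimp only [koszulContract, koszulExtend, koszulProj, LinearMap.coe_mk, AddHom.coe_mk,
    Pi.add_apply]
  split_ifs with hr hr'
  · exact absurd hr' (Finset.notMem_erase _ _)
  · rw [Finset.insert_erase hr, smul_smul, ← mul_pow]; simp
  · simp

/-- Since `r` is the largest index involved, adjoining it changes no sign `koszulSign t j` with `j <
r`. The factor `(-1) ^ #t` thus turns commutation into anticommutation, as the negated differential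
of the shift requires. -/
theorem koszulContract_koszulD (r : Fin m) {n : ℤ} {f : Finset (Fin m) → M}
    (hf : f ∈ koszulStageX A m M (r.1 + 1) n) :
    koszulContract A r (koszulD x M f) = -koszulD x M (koszulContract A r f) := by
  funext t
  dsimp only [koszulContract, koszulD, LinearMap.coe_mk, AddHom.coe_mk, Pi.neg_apply]
  split_ifs with hr
  · rw [Finset.sum_eq_zero, neg_zero]
    intro j _
    rw [if_pos (Finset.mem_insert_of_mem hr), smul_zero, smul_zero]
  · have hr' : r ∈ tᶜ := Finset.mem_compl.2 hr
    rw [← Finset.add_sum_erase _ _ hr', if_pos (Finset.mem_insert_self _ _), smul_zero, smul_zero,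
      zero_add, Finset.smul_sum, ← Finset.sum_neg_distrib, Finset.compl_insert]
    refine Finset.sum_congr rfl fun j hj => ?_
    obtain ⟨hjr, hj⟩ := Finset.mem_erase.1 hj
    rw [if_neg (by simp [hr, Ne.symm hjr]), Finset.card_insert_of_notMem (Finset.mem_compl.1 hj),
      Finset.insert_comm]
    by_cases hlt : j < r
    · have : koszulSign (insert r t) j = koszulSign t j := by
        unfold koszulSign
        rw [Finset.filter_insert, if_neg (not_lt.2 hlt.le)]
      rw [this, pow_succ, mul_neg_one, Units.neg_smul, smul_neg, smul_neg, neg_neg,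
        smul_comm ((-1 : ℤˣ) ^ t.card), smul_comm ((-1 : ℤˣ) ^ t.card) (x j)]
    · rw [hf _ fun h => hlt ?_]
      · simp
      · have := h.2 j (by simp)
        exact lt_of_le_of_ne (Fin.le_def.2 (by omega)) hjr

/-- Only the removal of `r` yields terms without `r`; its Koszul sign `(-1) ^ #t` cancels the sign
in `koszulExtend`. -/
theorem koszulProj_koszulD_koszulExtend (r : Fin m) {n : ℤ} {f : Finset (Fin m) → M}
    (hf : f ∈ koszulStageX A m M r.1 n) :
    koszulProj A r (koszulD x M (koszulExtend A r f)) = x r • f := by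
  funext t
  dsimp only [koszulProj, koszulExtend, koszulD, LinearMap.coe_mk, AddHom.coe_mk, Pi.smul_apply]
  split_ifs with hr
  · rw [hf t fun h => lt_irrefl _ (h.2 r hr), smul_zero]
  · rw [Finset.sum_eq_single_of_mem r (Finset.mem_compl.2 hr), if_pos (Finset.mem_insert_self _ _),
      Finset.erase_insert hr, smul_comm (x r), smul_smul]
    · by_cases ht : ∀ i ∈ t, i < r
      · rw [koszulSign, Finset.filter_true_of_mem ht, ← mul_pow]
        simp
      · rw [hf t fun h => ht h.2]
        simp
    · intro j hj hjr
      rw [if_neg (by simp [hr, Ne.symm hjr]), smul_zero, smul_zero]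

end KoszulFiltration

/-! ### The distinguished triangle of one Koszul step -/

section KoszulTriangle

variable {A : Type u} [CommRing A] {m : ℕ} (x : Fin m → A) (M : Type v) [AddCommGroup M]
  [Module A M]

/-- The inclusion of the Koszul complex of `x_1, …, x_r` in that of `x_1, …, x_{r + 1}`. -/
noncomputable def koszulStageι (r : ℕ) : koszulStage x M r ⟶ koszulStage x M (r + 1) where
  f n := ModuleCat.ofHom (Submodule.inclusion (koszulStageX_mono r.le_succ n))
  comm' n n' h := by
    ext f : 2
    apply Subtype.ext
    exact (koszulStage_d_apply x M (r + 1) h _).trans (koszulStage_d_apply x M r h _).symm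

/-- The projection from the Koszul complex of `x_1, …, x_{r + 1}` to the shift of that of
`x_1, …, x_r`. -/
noncomputable def koszulStageπ (r : Fin m) :
    koszulStage x M (r.1 + 1) ⟶ (koszulStage x M r.1)⟦(1 : ℤ)⟧ where
  f n := ModuleCat.ofHom ((koszulContract A r).restrict (koszulContract_mem r rfl))
  comm' n n' h := by
    ext f : 2
    obtain rfl : n + 1 = n' := h
    have hd : ((koszulStage x M r.1)⟦(1 : ℤ)⟧).d n (n + 1) =
        -(koszulStage x M r.1).d (n + 1) (n + 1 + 1) := by
      rw [CochainComplex.shiftFunctor_obj_d', Int.negOnePow_one, Units.neg_smul, one_smul]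
    rw [hd]
    apply Subtype.ext
    refine Eq.trans (congrArg Neg.neg (koszulStage_d_apply x M r.1 rfl _)) ?_
    refine Eq.trans ?_ (congrArg (koszulContract A r) (koszulStage_d_apply x M _ rfl _)).symm
    exact (koszulContract_koszulD x r f.2).symm

/-- The degreewise split short exact sequence relating the Koszul complexes of `x_1, …, x_r` and
of `x_1, …, x_{r + 1}`. -/
@[simps]
noncomputable def koszulStageShortComplex (r : Fin m) :
    ShortComplex (CochainComplex (ModuleCat.{v} A) ℤ) where
  X₁ := koszulStage x M r.1
  X₂ := koszulStage x M (r.1 + 1)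
  X₃ := (koszulStage x M r.1)⟦(1 : ℤ)⟧
  f := koszulStageι x M r.1
  g := koszulStageπ x M r
  zero := by
    ext n f : 3
    exact Subtype.ext (koszulContract_apply_of_mem r f.2)

/-- The degreewise splitting of `koszulStageShortComplex`. -/
noncomputable def koszulStageSplitting (r : Fin m) (n : ℤ) :
    ((koszulStageShortComplex x M r).map (HomologicalComplex.eval _ _ n)).Splitting where
  r := ModuleCat.ofHom ((koszulProj A r).restrict (koszulProj_mem r n))
  s := ModuleCat.ofHom ((koszulExtend A r).restrict (koszulExtend_mem r rfl))
  f_r := by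
    ext f : 2
    exact Subtype.ext (koszulProj_apply_of_mem r f.2)
  s_g := by
    ext f : 2
    exact Subtype.ext (koszulContract_koszulExtend r f.2)
  id := by
    ext f : 2
    exact Subtype.ext (koszulProj_add_koszulExtend_koszulContract (A := A) r f.1)

/-- The connecting map of a degreewise split sequence is section, differential, retraction, which is
the composite computed in `koszulProj_koszulD_koszulExtend`. -/
theorem homOfDegreewiseSplit_koszulStage (r : Fin m) :
    CochainComplex.homOfDegreewiseSplit (koszulStageShortComplex x M r)
      (koszulStageSplitting x M r) = x r • 𝟙 ((koszulStage x M r.1)⟦(1 : ℤ)⟧) := by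
  ext n f : 3
  rw [CochainComplex.homOfDegreewiseSplit_f]
  apply Subtype.ext
  change koszulProj A r ((koszulStage x M (r.1 + 1)).d n (n + 1)
    (⟨koszulExtend A r f.1, koszulExtend_mem r rfl f.1 f.2⟩ :
      koszulStageX A m M (r.1 + 1) n) : koszulStageX A m M (r.1 + 1) (n + 1)).1 = x r • f.1
  rw [koszulStage_d_apply x M _ rfl]
  exact koszulProj_koszulD_koszulExtend x r f.2

theorem DerivedCategory.mapTriangle_triangleOfDegreewiseSplit_distinguished
    {C : Type u} [Category.{v} C] [Abelian C] [HasDerivedCategory.{w} C]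
    (S : ShortComplex (CochainComplex C ℤ))
    (σ : ∀ n, (S.map (HomologicalComplex.eval C _ n)).Splitting) :
    DerivedCategory.Q.mapTriangle.obj (CochainComplex.triangleOfDegreewiseSplit S σ) ∈
      distTriang (DerivedCategory C) := by
  refine isomorphic_distinguished _ (Qh.map_distinguished _ ?_) _
    ((Functor.mapTriangleIso (quotientCompQhIso C)).symm.app _ ≪≫
    (Functor.mapTriangleCompIso (HomotopyCategory.quotient C _) Qh).app _)
  exact (HomotopyCategory.distinguished_iff_iso_trianglehOfDegreewiseSplit _).2
    ⟨S, σ, ⟨Iso.refl _⟩⟩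

variable [HasDerivedCategory.{w} (ModuleCat.{v} A)]

theorem exists_koszulStage_triangle (r : Fin m) :
    ∃ T ∈ distTriang (DerivedCategory (ModuleCat.{v} A)),
      T.obj₁ = DerivedCategory.Q.obj (koszulStage x M r.1) ∧
      T.obj₂ = DerivedCategory.Q.obj (koszulStage x M (r.1 + 1)) ∧
      ∃ e : T.obj₃ ⟶ T.obj₁⟦(1 : ℤ)⟧, T.mor₃ = x r • e := by
  refine ⟨_, DerivedCategory.mapTriangle_triangleOfDegreewiseSplit_distinguished
    (koszulStageShortComplex x M r) (koszulStageSplitting x M r), rfl, rfl,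
    (DerivedCategory.Q.commShiftIso (1 : ℤ)).hom.app (koszulStage x M r.1), ?_⟩
  refine (congrArg (fun f => DerivedCategory.Q.map f ≫
    (DerivedCategory.Q.commShiftIso (1 : ℤ)).hom.app (koszulStage x M r.1))
    (homOfDegreewiseSplit_koszulStage x M r)).trans ?_
  have (K : CochainComplex (ModuleCat.{v} A) ℤ) {Y} (c : DerivedCategory.Q.obj K ⟶ Y) :
      DerivedCategory.Q.map (x r • 𝟙 K) ≫ c = x r • c := by
    rw [Functor.map_smul, CategoryTheory.Functor.map_id, Linear.smul_comp, Category.id_comp]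
  exact this _ _

end KoszulTriangle

/-! ### Comparison with Koszul homology, and descent to `M` -/

section KoszulHomology

theorem smul_id_single_residueField_eq_zero {A : Type u} [CommRing A] [IsLocalRing A]
    [HasDerivedCategory.{w} (ModuleCat.{u} A)] {a : A} (ha : a ∈ IsLocalRing.maximalIdeal A) :
    a • 𝟙 ((singleFunctor (ModuleCat.{u} A) 0).obj
      (ModuleCat.of A (IsLocalRing.ResidueField A))) = 0 := by
  have : a • 𝟙 (ModuleCat.of A (IsLocalRing.ResidueField A)) = 0 := by
    ext y : 2
    change a • y = 0
    rw [Algebra.smul_def]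
    exact (congrArg (· * y) ((IsLocalRing.residue_eq_zero_iff a).2 ha)).trans (zero_mul y)
  rw [← CategoryTheory.Functor.map_id, ← Functor.map_smul, this, Functor.map_zero]

variable {A : Type u} [CommRing A] {m : ℕ} (x : Fin m → A) (M : Type v) [AddCommGroup M]
  [Module A M]

theorem koszulComplex_d_apply (n : ℕ) (f : koszulX A m M (n + 1)) :
    ((koszulComplex x M).d (n + 1) n f : koszulX A m M n).1 = koszulD x M f.1 := by
  have : (koszulComplex x M).d (n + 1) n =
      ModuleCat.ofHom ((koszulD x M).restrict (koszulD_mem x M n)) :=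
    ChainComplex.of_d (fun n => ModuleCat.of A (koszulX A m M n))
      (fun n => ModuleCat.ofHom ((koszulD x M).restrict (koszulD_mem x M n))) n
  rw [this]
  rfl

theorem koszulStageX_le_koszulX (n : ℤ) (i : ℕ) (h : ∀ k : ℕ, -(k : ℤ) = n → k = i) :
    koszulStageX A m M m n ≤ koszulX A m M i :=
  fun _ hf s hs => hf s fun h' => hs (h _ h'.1)

theorem koszulX_le_koszulStageX (n : ℤ) (i : ℕ) (h : -(i : ℤ) = n) :
    koszulX A m M i ≤ koszulStageX A m M m n :=
  fun _ hf s hs => hf s fun h' => hs ⟨by rw [h', h], fun i _ => i.2⟩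

/-- The comparison between the full stage of the filtration and the Koszul complex around a given
degree. -/
noncomputable def koszulStageToKoszulComplex (n : ℕ) :
    (koszulStage x M m).sc' (-((n + 1 : ℕ) : ℤ)) (-(n : ℤ)) (-(n : ℤ) + 1) ⟶
      (koszulComplex x M).sc' (n + 1) n (n - 1) where
  τ₁ := ModuleCat.ofHom (Submodule.inclusion
    (koszulStageX_le_koszulX M (-((n + 1 : ℕ) : ℤ)) (n + 1) (by omega)))
  τ₂ := ModuleCat.ofHom (Submodule.inclusion
    (koszulStageX_le_koszulX M (-(n : ℤ)) n (by omega)))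
  τ₃ := ModuleCat.ofHom (Submodule.inclusion
    (koszulStageX_le_koszulX M (-(n : ℤ) + 1) (n - 1) (by omega)))
  comm₁₂ := by
    ext f : 2
    apply Subtype.ext
    exact (koszulComplex_d_apply x M n _).trans (koszulStage_d_apply x M m (by omega) f).symm
  comm₂₃ := by
    ext f : 2
    apply Subtype.ext
    refine Eq.trans ?_ (koszulStage_d_apply x M m rfl f).symm
    -- For `n = 0` the truncated index `n - 1` is `0`: the differential from `0` to `0` vanishes by
    -- `shape`, and the stage is zero in degree `1`.
    cases n with
    | zero =>
      refine (congrArg (fun d : (koszulComplex x M).X 0 ⟶ (koszulComplex x M).X 0 =>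
        (d (⟨f.1, koszulStageX_le_koszulX M 0 0 (by omega) f.2⟩ : koszulX A m M 0) :
          koszulX A m M 0).1) ((koszulComplex x M).shape 0 0 (by simp))).trans ?_
      funext t
      exact (koszulD_mem_koszulStageX x M m rfl f.1 f.2 t fun h => by have := h.1; omega).symm
    | succ n => exact koszulComplex_d_apply x M n _

/-- The homology of the full stage of the filtration is Koszul homology. -/
noncomputable def koszulStageHomologyIso (n : ℕ) :
    (koszulStage x M m).homology (-(n : ℤ)) ≅ koszulHomology x M n :=
  have : Epi (koszulStageToKoszulComplex x M n).τ₁ := (ModuleCat.epi_iff_surjective _).2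
    fun f => ⟨⟨f.1, koszulX_le_koszulStageX M _ _ rfl f.2⟩, rfl⟩
  have : IsIso (koszulStageToKoszulComplex x M n).τ₂ := (ConcreteCategory.isIso_iff_bijective _).2
    ⟨Submodule.inclusion_injective (koszulStageX_le_koszulX M (-(n : ℤ)) n (by omega)),
      fun f => ⟨⟨f.1, koszulX_le_koszulStageX M _ _ rfl f.2⟩, rfl⟩⟩
  -- Only a monomorphism in general: for `n = 0` the source is zero while the target is the degree
  -- `0` term. That is enough for a quasi-isomorphism.
  have : Mono (koszulStageToKoszulComplex x M n).τ₃ := (ModuleCat.mono_iff_injective _).2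
    (Submodule.inclusion_injective (koszulStageX_le_koszulX M (-(n : ℤ) + 1) (n - 1) (by omega)))
  have := ShortComplex.quasiIso_of_epi_of_isIso_of_mono (koszulStageToKoszulComplex x M n)
  (koszulStage x M m).homologyIsoSc' _ _ _ (by simp; omega) (by simp) ≪≫
    asIso (ShortComplex.homologyMap (koszulStageToKoszulComplex x M n)) ≪≫
    ((koszulComplex x M).homologyIsoSc' (n + 1) n (n - 1) (by simp)
      (by cases n <;> simp)).symm

theorem isZero_koszulStage_X (r : ℕ) (n : ℤ)
    (h : ∀ s : Finset (Fin m), (∀ i ∈ s, i.1 < r) → -(s.card : ℤ) ≠ n) :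
    IsZero ((koszulStage x M r).X n) :=
  ModuleCat.isZero_of_iff_subsingleton.2 <| subsingleton_of_forall_eq (0 : koszulStageX A m M r n)
    fun f => Subtype.ext (funext fun s => f.2 s fun hs => h s hs.2 hs.1)

theorem nonempty_koszulStage_zero_iso_single :
    Nonempty (koszulStage x M 0 ≅
      (HomologicalComplex.single _ (ComplexShape.up ℤ) 0).obj (ModuleCat.of A M)) := by
  have hs : ∀ s : Finset (Fin m), (∀ i ∈ s, i.1 < 0) → s.card = 0 := fun s hs =>
    Finset.card_eq_zero.2 (Finset.eq_empty_of_forall_notMem fun i hi => Nat.not_lt_zero _ (hs i hi))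
  have : (koszulStage x M 0).IsStrictlyGE 0 := (CochainComplex.isStrictlyGE_iff _ _).2
    fun i hi => isZero_koszulStage_X x M 0 i fun s h => by rw [hs s h]; omega
  have : (koszulStage x M 0).IsStrictlyLE 0 := (CochainComplex.isStrictlyLE_iff _ _).2
    fun i hi => isZero_koszulStage_X x M 0 i fun s h => by rw [hs s h]; omega
  obtain ⟨N, ⟨e⟩⟩ := CochainComplex.exists_iso_single (koszulStage x M 0) 0
  let e₀ : koszulStageX A m M 0 0 ≃ₗ[A] M := LinearEquiv.ofBijective
    (LinearMap.proj ∅ ∘ₗ Submodule.subtype _) <| by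
      refine ⟨fun f g h => Subtype.ext (funext fun s => ?_), fun y => ⟨⟨Pi.single ∅ y, ?_⟩, ?_⟩⟩
      · by_cases h' : s = ∅
        · rw [h']; exact h
        · have : ¬ (-(s.card : ℤ) = 0 ∧ ∀ i ∈ s, i.1 < 0) := fun hs' =>
            h' (Finset.card_eq_zero.1 (hs s hs'.2))
          rw [f.2 s this, g.2 s this]
      · intro s h
        have hs : s ≠ ∅ := fun hs => h (by simp [hs])
        exact Pi.single_eq_of_ne (M := fun _ : Finset (Fin m) => M) hs y
      · change (Pi.single ∅ y : Finset (Fin m) → M) ∅ = y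
        exact Pi.single_eq_same _ _
  have e₁ : N ≅ ModuleCat.of A M :=
    (HomologicalComplex.singleObjXSelf (ComplexShape.up ℤ) 0 N).symm ≪≫
      (HomologicalComplex.Hom.isoApp e 0).symm ≪≫ e₀.toModuleIso
  exact ⟨e ≪≫ (HomologicalComplex.single _ _ 0).mapIso e₁⟩

variable [HasDerivedCategory.{w} (ModuleCat.{v} A)]

/-- The common core of both assertions: dévissage gives `P` for the full Koszul complex, and `cone`
removes one element at a time until only `M` remains. -/
theorem prop_single_of_prop_koszulHomology (P : ObjectProperty (DerivedCategory (ModuleCat.{v} A)))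
    [P.IsClosedUnderIsomorphisms] [P.IsTriangulatedClosed₂] [P.IsStableUnderShift ℤ]
    (zero : ∀ X, IsZero X → P X)
    (cone : ∀ T ∈ distTriang (DerivedCategory (ModuleCat.{v} A)), ∀ r,
      ∀ e : T.obj₃ ⟶ T.obj₁⟦(1 : ℤ)⟧, T.mor₃ = x r • e → P T.obj₂ → P T.obj₁)
    (h : ∀ n, P ((singleFunctor _ 0).obj (koszulHomology x M n))) :
    P ((singleFunctor _ 0).obj (ModuleCat.of A M)) := by
  have h₀ : P (Q.obj (koszulStage x M m)) := by
    have : (koszulStage x M m).IsStrictlyGE (-m) := (CochainComplex.isStrictlyGE_iff _ _).2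
      fun i hi => isZero_koszulStage_X x M m i fun s _ => by
        have := s.card_le_univ
        rw [Fintype.card_fin] at this
        omega
    have : (koszulStage x M m).IsStrictlyLE 0 := (CochainComplex.isStrictlyLE_iff _ _).2
      fun i hi => isZero_koszulStage_X x M m i fun s _ => by omega
    refine prop_of_prop_homology P zero _ (-m) 0 fun i => ?_
    rw [prop_single_iff P]
    by_cases hi : 0 < i
    · exact zero _ ((singleFunctor _ 0).map_isZero (isZero_of_isLE _ 0 i hi))
    · obtain ⟨n, rfl⟩ := Int.exists_eq_neg_ofNat (not_lt.1 hi)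
      exact P.prop_of_iso ((singleFunctor _ 0).mapIso ((koszulStageHomologyIso x M n).symm ≪≫
        ((homologyFunctorFactors _ (-(n : ℤ))).app (koszulStage x M m)).symm)) (h n)
  have h₁ : P (Q.obj (koszulStage x M 0)) := by
    refine Nat.decreasingInduction (motive := fun r _ => P (Q.obj (koszulStage x M r)))
      (fun r hr ih => ?_) h₀ (Nat.zero_le m)
    obtain ⟨T, hT, h₁, h₂, e, he⟩ := exists_koszulStage_triangle x M ⟨r, hr⟩
    rw [← h₁]
    exact cone T hT _ e he (h₂ ▸ ih)
  obtain ⟨e⟩ := nonempty_koszulStage_zero_iso_single x M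
  exact P.prop_of_iso (Q.mapIso e ≪≫
    ((singleFunctorIsoCompQ _ 0).app (ModuleCat.of A M)).symm) h₁

end KoszulHomology

/-! ### The two assertions, by orthogonality to the residue field -/

theorem theorem1p5 (A : Type u) [CommRing A] [IsNoetherianRing A] [IsLocalRing A]
    (M : Type u) [AddCommGroup M] [Module A M] [Module.Finite A M]
    (I : Ideal A) (hI : I ≠ ⊤) (m : ℕ) (x : Fin m → A)
    (hx : IsMinimalGeneratingSequence x I) :
    ((∀ i : ℕ, CategoryTheory.projectiveDimension (koszulHomology x M i) ≠ ⊤) →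
      CategoryTheory.projectiveDimension (ModuleCat.of A M) ≠ ⊤) ∧
    ((∀ i : ℕ, CategoryTheory.injectiveDimension (koszulHomology x M i) ≠ ⊤) →
      CategoryTheory.injectiveDimension (ModuleCat.of A M) ≠ ⊤) := by
  let := HasDerivedCategory.standard (ModuleCat.{u} A)
  -- Properness of `I` enters here: it makes every generator act as zero on the residue field.
  have hxm : ∀ r, x r ∈ IsLocalRing.maximalIdeal A := fun r =>
    IsLocalRing.le_maximalIdeal hI (hx.1 ▸ Ideal.subset_span ⟨r, rfl⟩)
  simp only [projectiveDimension_ne_top_iff, injectiveDimension_ne_top_iff]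
  refine ⟨fun h => ?_, fun h => ?_⟩
  · have hM := prop_single_of_prop_koszulHomology x M (eventuallyLeftOrthogonal
      ((singleFunctor (ModuleCat.{u} A) 0).obj (ModuleCat.of A (IsLocalRing.ResidueField A))))
      (fun _ => eventuallyLeftOrthogonal_of_isZero)
      (fun T hT r e he => eventuallyLeftOrthogonal_of_cone
        (smul_id_single_residueField_eq_zero (hxm r)) hT e he)
      (fun n => by
        obtain ⟨d, hd⟩ := h n
        exact (eventuallyLeftOrthogonal_single_iff _ _).2
          ⟨d + 1, fun i hi => HasProjectiveDimensionLT.subsingleton _ (d + 1) i hi _⟩)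
    obtain ⟨n, hn⟩ := (eventuallyLeftOrthogonal_single_iff _ _).1 hM
    exact ⟨n, ModuleCat.hasProjectiveDimensionLE_of_subsingleton_ext n _ fun N _ =>
      ModuleCat.subsingleton_ext_right_of_residueField _ n hn N _ n.le_succ⟩
  · have hM := prop_single_of_prop_koszulHomology x M (eventuallyRightOrthogonal
      ((singleFunctor (ModuleCat.{u} A) 0).obj (ModuleCat.of A (IsLocalRing.ResidueField A))))
      (fun _ => eventuallyRightOrthogonal_of_isZero)
      (fun T hT r e he => eventuallyRightOrthogonal_of_cone
        (smul_id_single_residueField_eq_zero (hxm r)) hT e he)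
      (fun n => by
        obtain ⟨d, hd⟩ := h n
        exact (eventuallyRightOrthogonal_single_iff _ _).2
          ⟨d + 1, fun i hi => HasInjectiveDimensionLT.subsingleton _ (d + 1) i hi _⟩)
    obtain ⟨n, hn⟩ := (eventuallyRightOrthogonal_single_iff _ _).1 hM
    exact ⟨n, ModuleCat.hasInjectiveDimensionLE_of_subsingleton_ext n _ fun N _ =>
      ModuleCat.subsingleton_ext_left_of_residueField _ n hn N _ n.le_succ⟩
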